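/- **Setting.** Let $\Omega\subset\mathbb R^2$ be a bounded open set (for instance a polygonal domain), let $\Omega^-$ be an open set with $\overline{\Omega^-}\subset\Omega$ whose boundary $\Gamma=\partial\Omega^-$ (the closed interface) is of class $C^2$, i.e. near each point of $\Gamma$, in suitable orthonormal coordinates, $\Omega^-$ is the strict subgraph of a $C^2$ function; put $\Omega^+=\Omega\setminus\overline{\Omega^-}$. Let $\beta^-,\beta^+>0$, $\alpha>0$ and $u_a<u_b$ be real constants, and let $f,y_d\in L^2(\Omega)$. Let $L^2(\Gamma)$ be taken with respect to arc length, let $H^1_0(\Omega)$ be the closure of $C_c^\infty(\Omega)$ in the $H^1$ norm, and let $v|_\Gamma\in L^2(\Gamma)$ denote the trace of $v\in H^1_0(\Omega)$. Write $$a(y,v)=\int_{\Omega^-}\beta^-\nabla y\cdot\nabla v\,dx+\int_{\Omega^+}\beta^+\nabla y\cdot\nabla v\,dx,\qquad (f,v)=\int_\Omega fv\,dx,\qquad \langle u,v\rangle=\int_\Gamma uv\,d\Gamma,$$ where in $\langle\cdot,\cdot\rangle$ a function in $H^1_0(\Omega)$ is replaced by its trace on $\Gamma$. For $u\in L^2(\Gamma)$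 let $Su\in H^1_0(\Omega)$ be the unique weak solution of the interface problem with flux jump $u$, that is, $a(Su,v)=(f,v)+\langle u,v\rangle$ for all $v\in H^1_0(\Omega)$. Let $$U_{ad}=\{u\in L^2(\Gamma): u_a\le u\le u_b\ \text{a.e. on }\Gamma\},\qquad \widehat J(u)=\tfrac12\int_\Omega (Su-y_d)^2\,dx+\tfrac\alpha2\int_\Gamma u^2\,d\Gamma .$$ A pair $(y^*,u^*)$ is a solution of the interface control problem $(\mathbf P)$ if $u^*\in U_{ad}$, $y^*=Su^*$, and $\widehat J(u^*)\le\widehat J(u)$ for all $u\in U_{ad}$. **Theorem.** Let $(y^*,u^*)$ be a solution of $(\mathbf P)$. Then there is an adjoint state $p^*\in H^1_0(\Omega)$ such that $$a(y^*,v)=(f,v)+\langle u^*,v\rangle\quad\forall v\in H^1_0(\Omega),$$ $$a(v,p^*)=(Su^*-y_d,v)\quad\forall v\in H^1_0(\Omega),$$ $$\langle\alpha u^*+p^*,u-u^*\rangle\ge0\quad\forall u\in U_{ad},$$ and $$u^*=\mathcal P_{[u_a,u_b]}\Bigl(-\tfrac1\alpha p^*|_\Gamma\Bigr)\ \text{ a.e.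 on }\Gamma,\qquad \mathcal P_{[u_a,u_b]}(c)=\min\{u_b,\max\{u_a,c\}\}.$$ Moreover the variational inequality is equivalent to the projection equation: for every $w\in U_{ad}$ and every $q\in H^1_0(\Omega)$, $$\langle\alpha w+q,u-w\rangle\ge0\ \ \forall u\in U_{ad}\quad\Longleftrightarrow\quad w=\mathcal P_{[u_a,u_b]}\Bigl(-\tfrac1\alpha q|_\Gamma\Bigr)\ \text{ a.e. on }\Gamma .$$ -/

import Mathlib

open MeasureTheory Set TopologicalSpace
open scoped Distributions Gradient NNReal ENNReal Topology InnerProductSpace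

noncomputable section

namespace InterfaceControl

/-- The Euclidean plane. -/
abbrev Plane : Type := EuclideanSpace ℝ (Fin 2)

/-! ## Geometry -/

/-- Near the boundary point `x₀`, the set `U` is the strict subgraph of a `C²` function in a suitable
orthonormal coordinate system centred at `x₀`. -/
def IsC2SubgraphAt (U : Set Plane) (x₀ : Plane) : Prop :=
  ∃ (b : OrthonormalBasis (Fin 2) ℝ Plane) (g : ℝ → ℝ) (r h : ℝ),
    0 < r ∧ 0 < h ∧ ContDiff ℝ 2 g ∧ g 0 = 0 ∧
    ∀ s t : ℝ, |s| < r → |t - g s| < h → (x₀ + s • b 0 + t • b 1 ∈ U ↔ t < g s)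

/-- A bounded open set `Ω` of the plane with an open subset `Ω⁻ = inner` lying strictly inside `Ω`
whose boundary, the closed interface `Γ = ∂Ω⁻`, is of class `C²`. -/
structure InterfaceGeometry where
  Ω : Opens Plane
  inner : Opens Plane
  isBounded : Bornology.IsBounded (Ω : Set Plane)
  closure_inner_subset : closure (inner : Set Plane) ⊆ Ω
  isC2 : ∀ x ∈ frontier (inner : Set Plane), IsC2SubgraphAt inner x

namespace InterfaceGeometry

variable (D : InterfaceGeometry)

/-- The interface `Γ`. -/
def Γ : Set Plane := frontier (D.inner : Set Plane)

/-- The subdomain `Ω⁺ = Ω \ (Ω⁻ ∪ Γ)`. -/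
def outer : Set Plane := (D.Ω : Set Plane) \ closure (D.inner : Set Plane)

/-- Lebesgue measure on `Ω`. -/
abbrev μΩ : Measure Plane := volume.restrict (D.Ω : Set Plane)

/-- Arc length on `Γ`: the one-dimensional Hausdorff measure restricted to `Γ`. -/
abbrev μΓ : Measure Plane := (μH[1] : Measure Plane).restrict D.Γ

end InterfaceGeometry

/-! ## The interface has finite length, and test functions obey the trace inequality -/

lemma isCompact_Γ (D : InterfaceGeometry) : IsCompact D.Γ :=
  Metric.isCompact_of_isClosed_isBounded isClosed_frontier
    (D.isBounded.subset (frontier_subset_closure.trans D.closure_inner_subset))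

/-- Near a point of `Γ`, the interface is contained in a Lipschitz graph. -/
lemma exists_local_graph (D : InterfaceGeometry) {x₀ : Plane} (hx : x₀ ∈ D.Γ) :
    ∃ (b : OrthonormalBasis (Fin 2) ℝ Plane) (g : ℝ → ℝ) (r : ℝ) (K : ℝ≥0) (V : Set Plane),
      Continuous g ∧ V ∈ 𝓝 x₀ ∧
      LipschitzOnWith K (fun s : ℝ => x₀ + s • b 0 + g s • b 1) (Icc (-r) r) ∧
      D.Γ ∩ V ⊆ (fun s : ℝ => x₀ + s • b 0 + g s • b 1) '' Icc (-r) r := by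
  obtain ⟨b, g, r, h, hr, hh, hg, hg0, H⟩ := D.isC2 x₀ hx
  have hrec : ∀ x : Plane, x₀ + (⟪b 0, x - x₀⟫_ℝ) • b 0 + (⟪b 1, x - x₀⟫_ℝ) • b 1 = x := by
    intro x
    have := b.sum_repr' (x - x₀)
    rw [Fin.sum_univ_two] at this
    rw [add_assoc, this]; abel
  set V : Set Plane := {x | |⟪b 0, x - x₀⟫_ℝ| < r ∧
    |⟪b 1, x - x₀⟫_ℝ - g ⟪b 0, x - x₀⟫_ℝ| < h} with hV
  have hgc := hg.continuous
  have hVo : IsOpen V := by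
    have h1 : IsOpen {x : Plane | |⟪b 0, x - x₀⟫_ℝ| < r} := isOpen_lt (by fun_prop) (by fun_prop)
    have h2 : IsOpen {x : Plane | |⟪b 1, x - x₀⟫_ℝ - g ⟪b 0, x - x₀⟫_ℝ| < h} :=
      isOpen_lt (by fun_prop) (by fun_prop)
    exact h1.inter h2
  refine ⟨b, g, r, ?_⟩
  have hlip : ContDiff ℝ 2 (fun s : ℝ => x₀ + s • b 0 + g s • b 1) := by fun_prop
  obtain ⟨K, hK⟩ := hlip.contDiffOn.exists_lipschitzOnWith (s := Icc (-r) r) (by norm_num)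
    (convex_Icc _ _) isCompact_Icc
  refine ⟨K, V, hg.continuous, hVo.mem_nhds (by simp [hV, hg0, hr, hh]), hK, ?_⟩
  rintro x ⟨hxΓ, hxV⟩
  have hxV' := hxV
  obtain ⟨h1, h2⟩ := hxV
  refine ⟨⟪b 0, x - x₀⟫_ℝ, ⟨(abs_lt.1 h1).1.le, (abs_lt.1 h1).2.le⟩, ?_⟩
  suffices he : g ⟪b 0, x - x₀⟫_ℝ = ⟪b 1, x - x₀⟫_ℝ by
    simp only [he]; exact hrec x
  by_contra hne
  rcases lt_or_gt_of_ne hne with hlt | hgt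
  · -- above the graph: a neighbourhood misses `Ω⁻`
    have hopen : IsOpen (V ∩ {x | g ⟪b 0, x - x₀⟫_ℝ < ⟪b 1, x - x₀⟫_ℝ}) := by
      exact hVo.inter (isOpen_lt (by fun_prop) (by fun_prop))
    have hcl : x ∈ closure (D.inner : Set Plane) := frontier_subset_closure hxΓ
    obtain ⟨z, ⟨hzV, hz⟩, hzU⟩ := mem_closure_iff.1 hcl _ hopen ⟨hxV', hlt⟩
    have := (H _ _ hzV.1 hzV.2).1 (by rw [hrec z]; exact hzU)
    exact absurd this (not_lt.2 (le_of_lt hz))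
  · have hxU : x ∈ (D.inner : Set Plane) := by
      have := (H _ _ h1 h2).2 hgt
      rwa [hrec x] at this
    have : x ∈ frontier (D.inner : Set Plane) := hxΓ
    rw [D.inner.isOpen.frontier_eq] at this
    exact this.2 hxU

/-- Arc length on a Lipschitz curve is dominated by the parameter. -/
lemma restrict_image_le {c : ℝ → Plane} {K : ℝ≥0} {I : Set ℝ}
    (hc : Continuous c) (hL : LipschitzOnWith K c I) :
    (μH[1] : Measure Plane).restrict (c '' I) ≤ (K : ℝ≥0∞) • (volume.restrict I).map c := by
  refine Measure.le_iff.2 fun B hB => ?_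
  rw [Measure.restrict_apply hB, Measure.smul_apply, Measure.map_apply hc.measurable hB,
    Measure.restrict_apply (hc.measurable hB), inter_comm B, ← image_inter_preimage]
  have := (hL.mono (inter_subset_right (s := c ⁻¹' B))).hausdorffMeasure_image_le (d := 1) zero_le_one
  rw [ENNReal.rpow_one, hausdorffMeasure_real] at this
  simpa [inter_comm] using this

/-- Orthonormal coordinates preserve Lebesgue measure. -/
lemma measurePreserving_coords (b : OrthonormalBasis (Fin 2) ℝ Plane) (x₀ : Plane) :
    MeasurePreserving (fun q : ℝ × ℝ => x₀ + q.1 • b 0 + q.2 • b 1) := by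
  have h1 := (volume_preserving_finTwoArrow ℝ).symm
  have h2 := b.measurePreserving_repr_symm.comp ((PiLp.volume_preserving_toLp (Fin 2)).comp h1)
  have h3 := (measurePreserving_add_left (volume : Measure Plane) x₀).comp h2
  have he : (fun q : ℝ × ℝ => x₀ + q.1 • b 0 + q.2 • b 1) = (fun x => x₀ + x) ∘ ⇑b.repr.symm ∘
      WithLp.toLp 2 ∘ ⇑(MeasurableEquiv.finTwoArrow (α := ℝ)).symm := by
    ext1 q
    change _ = x₀ + b.repr.symm _
    rw [add_assoc, ← b.sum_repr_symm, Fin.sum_univ_two]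
    rfl
  rw [he]
  exact h3

lemma continuous_gradient {φ : Plane → ℝ} (hφ : ContDiff ℝ 1 φ) : Continuous (∇ φ) :=
  (InnerProductSpace.toDual ℝ Plane).symm.continuous.comp (hφ.continuous_fderiv one_ne_zero)

/-- The trace inequality on a graph. -/
lemma lintegral_graph_le (b : OrthonormalBasis (Fin 2) ℝ Plane) (x₀ : Plane) {g : ℝ → ℝ}
    (I : Set ℝ) {φ : Plane → ℝ} (hφ : ContDiff ℝ 1 φ) (hc : HasCompactSupport φ) :
    ∫⁻ s in I, ‖φ (x₀ + s • b 0 + g s • b 1)‖ₑ ^ 2 ≤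
      ∫⁻ x, (‖φ x‖ₑ ^ 2 + ‖∇ φ x‖ₑ ^ 2) := by
  set G : ℝ × ℝ → Plane := fun q => x₀ + q.1 • b 0 + q.2 • b 1 with hG
  have hH : Measurable fun x => ‖φ x‖ₑ ^ 2 + ‖∇ φ x‖ₑ ^ 2 := by
    have h1 : Measurable (∇ φ) := (continuous_gradient hφ).measurable
    have h2 := hφ.continuous.measurable
    fun_prop
  have key : ∀ s : ℝ, ‖φ (x₀ + s • b 0 + g s • b 1)‖ₑ ^ 2 ≤
      ∫⁻ t : ℝ, (‖φ (G (s, t))‖ₑ ^ 2 + ‖∇ φ (G (s, t))‖ₑ ^ 2) := by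
    intro s
    have hline : ContDiff ℝ 1 fun t : ℝ => x₀ + s • b 0 + t • b 1 := by fun_prop
    have hiso : Isometry fun t : ℝ => x₀ + s • b 0 + t • b 1 := by
      refine Isometry.of_dist_eq fun t t' => ?_
      rw [dist_add_left, dist_eq_norm, ← sub_smul, norm_smul, b.norm_eq_one, mul_one, Real.dist_eq,
        Real.norm_eq_abs]
    have hcs : HasCompactSupport fun t : ℝ => φ (x₀ + s • b 0 + t • b 1) :=
      hc.comp_isClosedEmbedding hiso.isClosedEmbedding
    have hcs2 : HasCompactSupport fun t : ℝ => φ (x₀ + s • b 0 + t • b 1) ^ 2 :=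
      hcs.comp_left (g := fun c : ℝ => c ^ 2) (by simp)
    have h1 := HasCompactSupport.enorm_le_lintegral_Ici_deriv ((hφ.comp hline).pow 2) hcs2 (g s)
    have h2 : ∀ t : ℝ, ‖deriv (fun t : ℝ => φ (x₀ + s • b 0 + t • b 1) ^ 2) t‖ₑ ≤
        ‖φ (G (s, t))‖ₑ ^ 2 + ‖∇ φ (G (s, t))‖ₑ ^ 2 := by
      intro t
      have hd : HasDerivAt (fun t : ℝ => x₀ + s • b 0 + t • b 1) (b 1) t := by
        simpa using ((hasDerivAt_id t).smul_const (b 1)).const_add (x₀ + s • b 0)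
      have hf := ((hφ.differentiable one_ne_zero) (G (s, t))).hasFDerivAt
      have hd2 := (hf.comp_hasDerivAt t hd).pow 2
      have hd3 : deriv (fun t : ℝ => φ (x₀ + s • b 0 + t • b 1) ^ 2) t =
          2 * φ (G (s, t)) * fderiv ℝ φ (G (s, t)) (b 1) := by
        refine Eq.trans (b := (2 : ℕ) * φ (G (s, t)) ^ (2 - 1) * fderiv ℝ φ (G (s, t)) (b 1))
          hd2.deriv ?_
        simp
      rw [hd3]
      have hn : |fderiv ℝ φ (G (s, t)) (b 1)| ≤ ‖∇ φ (G (s, t))‖ := by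
        have := (fderiv ℝ φ (G (s, t))).le_opNorm (b 1)
        rw [b.norm_eq_one, mul_one, Real.norm_eq_abs] at this
        simpa [gradient] using this
      have hr : ‖2 * φ (G (s, t)) * fderiv ℝ φ (G (s, t)) (b 1)‖ ≤
          ‖φ (G (s, t))‖ ^ 2 + ‖∇ φ (G (s, t))‖ ^ 2 := by
        rw [norm_mul, norm_mul, Real.norm_eq_abs (fderiv ℝ φ (G (s, t)) (b 1)), Real.norm_ofNat]
        have h0 := norm_nonneg (φ (G (s, t)))
        nlinarith [sq_nonneg (‖φ (G (s, t))‖ - ‖∇ φ (G (s, t))‖),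
          mul_le_mul_of_nonneg_left hn h0]
      rw [← ofReal_norm, ← ofReal_norm, ← ofReal_norm, ← ENNReal.ofReal_pow (norm_nonneg _),
        ← ENNReal.ofReal_pow (norm_nonneg _), ← ENNReal.ofReal_add (by positivity) (by positivity)]
      exact ENNReal.ofReal_le_ofReal hr
    calc ‖φ (x₀ + s • b 0 + g s • b 1)‖ₑ ^ 2
        = ‖φ (x₀ + s • b 0 + g s • b 1) ^ 2‖ₑ := (enorm_pow _ _).symm
      _ ≤ ∫⁻ t in Iic (g s), ‖deriv (fun t : ℝ => φ (x₀ + s • b 0 + t • b 1) ^ 2) t‖ₑ := h1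
      _ ≤ ∫⁻ t, ‖deriv (fun t : ℝ => φ (x₀ + s • b 0 + t • b 1) ^ 2) t‖ₑ :=
        setLIntegral_le_lintegral _ _
      _ ≤ _ := lintegral_mono h2
  have hmp : MeasurePreserving G := measurePreserving_coords b x₀
  calc ∫⁻ s in I, ‖φ (x₀ + s • b 0 + g s • b 1)‖ₑ ^ 2
      ≤ ∫⁻ s, ‖φ (x₀ + s • b 0 + g s • b 1)‖ₑ ^ 2 := setLIntegral_le_lintegral _ _
    _ ≤ ∫⁻ s : ℝ, ∫⁻ t : ℝ, (‖φ (G (s, t))‖ₑ ^ 2 + ‖∇ φ (G (s, t))‖ₑ ^ 2) := lintegral_mono key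
    _ = ∫⁻ q : ℝ × ℝ, (‖φ (G q)‖ₑ ^ 2 + ‖∇ φ (G q)‖ₑ ^ 2) :=
      (lintegral_prod (fun q : ℝ × ℝ => ‖φ (G q)‖ₑ ^ 2 + ‖∇ φ (G q)‖ₑ ^ 2)
        (hH.comp hmp.measurable).aemeasurable).symm
    _ = ∫⁻ x, (‖φ x‖ₑ ^ 2 + ‖∇ φ x‖ₑ ^ 2) := hmp.lintegral_comp hH

/-- The trace inequality for `C¹` functions with compact support. -/
lemma exists_trace_bound (D : InterfaceGeometry) :
    D.μΓ univ < ∞ ∧ ∃ C : ℝ≥0, ∀ φ : Plane → ℝ, ContDiff ℝ 1 φ → HasCompactSupport φ →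
      ∫⁻ x, ‖φ x‖ₑ ^ 2 ∂D.μΓ ≤ C * ∫⁻ x, (‖φ x‖ₑ ^ 2 + ‖∇ φ x‖ₑ ^ 2) := by
  have main : (μH[1] : Measure Plane) (D.Γ ∩ D.Γ) < ∞ ∧ ∃ C : ℝ≥0, ∀ φ : Plane → ℝ,
      ContDiff ℝ 1 φ → HasCompactSupport φ →
      ∫⁻ x in D.Γ ∩ D.Γ, ‖φ x‖ₑ ^ 2 ∂μH[1] ≤ C * ∫⁻ x, (‖φ x‖ₑ ^ 2 + ‖∇ φ x‖ₑ ^ 2) := by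
    refine (isCompact_Γ D).induction_on
      (p := fun A => (μH[1] : Measure Plane) (D.Γ ∩ A) < ∞ ∧ ∃ C : ℝ≥0, ∀ φ : Plane → ℝ,
        ContDiff ℝ 1 φ → HasCompactSupport φ →
        ∫⁻ x in D.Γ ∩ A, ‖φ x‖ₑ ^ 2 ∂μH[1] ≤ C * ∫⁻ x, (‖φ x‖ₑ ^ 2 + ‖∇ φ x‖ₑ ^ 2)) ?_ ?_ ?_ ?_
    · refine ⟨by simp, 0, fun φ _ _ => by simp⟩
    · rintro A B hAB ⟨h1, C, h2⟩
      exact ⟨(measure_mono (inter_subset_inter_right _ hAB)).trans_lt h1, C, fun φ hφ hc =>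
        (lintegral_mono_set (inter_subset_inter_right _ hAB)).trans (h2 φ hφ hc)⟩
    · rintro A B ⟨h1, C, h2⟩ ⟨h3, C', h4⟩
      rw [inter_union_distrib_left]
      refine ⟨(measure_union_le _ _).trans_lt (ENNReal.add_lt_top.2 ⟨h1, h3⟩), C + C',
        fun φ hφ hc => (lintegral_union_le _ _ _).trans ?_⟩
      rw [ENNReal.coe_add, add_mul]
      exact add_le_add (h2 φ hφ hc) (h4 φ hφ hc)
    · intro x hx
      obtain ⟨b, g, r, K, V, hg, hV, hL, hsub⟩ := exists_local_graph D hx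
      have hcc : Continuous fun s : ℝ => x + s • b 0 + g s • b 1 := by fun_prop
      have hle := restrict_image_le (I := Icc (-r) r) hcc hL
      refine ⟨V, mem_nhdsWithin_of_mem_nhds hV, ?_, K, fun φ hφ hc => ?_⟩
      · refine (measure_mono hsub).trans_lt ?_
        have h1 := hL.hausdorffMeasure_image_le (d := 1) zero_le_one
        rw [ENNReal.rpow_one, hausdorffMeasure_real] at h1
        exact h1.trans_lt (ENNReal.mul_lt_top ENNReal.coe_lt_top isCompact_Icc.measure_lt_top)
      · have hm : Measurable fun x => ‖φ x‖ₑ ^ 2 := by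
          have h2 := hφ.continuous.measurable
          fun_prop
        refine (lintegral_mono_set hsub).trans ((lintegral_mono' hle le_rfl).trans ?_)
        rw [lintegral_smul_measure, lintegral_map hm hcc.measurable, smul_eq_mul]
        gcongr
        exact lintegral_graph_le b x (Icc (-r) r) hφ hc
  rw [inter_self] at main
  rwa [Measure.restrict_apply_univ]

instance (D : InterfaceGeometry) : IsFiniteMeasure D.μΓ := ⟨(exists_trace_bound D).1⟩

/-- The interface is a Lebesgue null set. -/
lemma volume_Γ (D : InterfaceGeometry) : volume D.Γ = 0 := by
  have h1 : (μH[1] : Measure Plane) D.Γ < ∞ := by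
    have := (exists_trace_bound D).1
    rwa [Measure.restrict_apply_univ] at this
  have h2 : (μH[(2 : ℕ)] : Measure Plane) D.Γ = 0 :=
    (Measure.hausdorffMeasure_zero_or_top (by norm_num : (1 : ℝ) < (2 : ℕ)) D.Γ).resolve_right h1.ne
  have h3 : (Measure.IsAddHaarMeasure (μH[(2 : ℕ)] : Measure Plane)) := by
    simpa using isAddHaarMeasure_hausdorffMeasure (E := Plane)
  exact Measure.absolutelyContinuous_isAddHaarMeasure volume (μH[(2 : ℕ)] : Measure Plane) h2

/-! ## Function spaces -/

/-- `L²(Ω)`. -/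
abbrev L2 (D : InterfaceGeometry) : Type := Lp ℝ 2 D.μΩ

/-- `L²(Ω)²`. -/
abbrev L2Vec (D : InterfaceGeometry) : Type := Lp Plane 2 D.μΩ

/-- `L²(Γ)`. -/
abbrev L2Γ (D : InterfaceGeometry) : Type := Lp ℝ 2 D.μΓ

lemma memLp_test {D : InterfaceGeometry} (φ : 𝓓(D.Ω, ℝ)) (μ : Measure Plane)
    [IsFiniteMeasureOnCompacts μ] : MemLp φ 2 μ :=
  φ.continuous.memLp_of_hasCompactSupport φ.hasCompactSupport

lemma differentiable_test {D : InterfaceGeometry} (φ : 𝓓(D.Ω, ℝ)) : Differentiable ℝ φ :=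
  φ.contDiff.differentiable (by simp)

lemma memLp_grad_test {D : InterfaceGeometry} (φ : 𝓓(D.Ω, ℝ)) (μ : Measure Plane)
    [IsFiniteMeasureOnCompacts μ] : MemLp (∇ (φ : Plane → ℝ)) 2 μ := by
  have h1 : Continuous (∇ (φ : Plane → ℝ)) :=
    (InnerProductSpace.toDual ℝ Plane).symm.continuous.comp
      (φ.contDiff.continuous_fderiv (by simp))
  refine h1.memLp_of_hasCompactSupport ?_
  exact (φ.hasCompactSupport.fderiv (𝕜 := ℝ)).comp_left
    (g := (InnerProductSpace.toDual ℝ Plane).symm) (map_zero _)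

/-- The pair `(φ, ∇φ)` of a test function `φ ∈ C_c^∞(Ω)`, as an element of the Hilbert space
`L²(Ω) × L²(Ω)²`, on whose elements `(v, ∇v)` the norm is the `H¹(Ω)` norm. -/
def testPair (D : InterfaceGeometry) : 𝓓(D.Ω, ℝ) →ₗ[ℝ] WithLp 2 (L2 D × L2Vec D) where
  toFun φ := WithLp.toLp 2 ((memLp_test φ D.μΩ).toLp φ,
    (memLp_grad_test φ D.μΩ).toLp (∇ (φ : Plane → ℝ)))
  map_add' φ ψ := by
    rw [← WithLp.toLp_add, Prod.mk_add_mk, ← MemLp.toLp_add, ← MemLp.toLp_add]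
    congr 2
    refine MemLp.toLp_congr _ _ (.of_forall fun x => ?_)
    simp only [gradient, FunLike.coe_add, Pi.add_apply]
    rw [fderiv_add (differentiable_test φ x) (differentiable_test ψ x), map_add]
  map_smul' c φ := by
    rw [RingHom.id_apply, ← WithLp.toLp_smul, Prod.smul_mk, ← MemLp.toLp_const_smul,
      ← MemLp.toLp_const_smul]
    congr 2
    refine MemLp.toLp_congr _ _ (.of_forall fun x => ?_)
    simp only [gradient, FunLike.coe_smul, Pi.smul_apply]
    rw [fderiv_const_smul (differentiable_test φ x)]
    simp

/-- `H¹₀(Ω)`: the closure of `C_c^∞(Ω)` for the `H¹(Ω)` norm. An element is stored as the pair of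
the function and its weak gradient. -/
def H10 (D : InterfaceGeometry) : Submodule ℝ (WithLp 2 (L2 D × L2Vec D)) :=
  (LinearMap.range (testPair D)).topologicalClosure

instance (D : InterfaceGeometry) : CompleteSpace (H10 D) :=
  (Submodule.isClosed_topologicalClosure _).completeSpace_coe

/-- The function underlying an element of `H¹₀(Ω)`. -/
def fn (D : InterfaceGeometry) : H10 D →L[ℝ] L2 D :=
  (WithLp.fstL 2 ℝ (L2 D) (L2Vec D)).comp (H10 D).subtypeL

/-- The weak gradient of an element of `H¹₀(Ω)`. -/
def grad (D : InterfaceGeometry) : H10 D →L[ℝ] L2Vec D :=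
  (WithLp.sndL 2 ℝ (L2 D) (L2Vec D)).comp (H10 D).subtypeL

lemma H10_norm_sq {D : InterfaceGeometry} (v : H10 D) : ‖v‖ ^ 2 = ‖fn D v‖ ^ 2 + ‖grad D v‖ ^ 2 :=
  WithLp.prod_norm_sq_eq_of_L2 (v : WithLp 2 (L2 D × L2Vec D))

/-- The embedding of `C_c^∞(Ω)` into `H¹₀(Ω)`. -/
def ofTest (D : InterfaceGeometry) : 𝓓(D.Ω, ℝ) →ₗ[ℝ] H10 D :=
  (testPair D).codRestrict (H10 D) fun φ =>
    Submodule.le_topologicalClosure _ (LinearMap.mem_range_self _ φ)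

lemma denseRange_ofTest (D : InterfaceGeometry) : DenseRange (ofTest D) := by
  intro v
  rw [closure_subtype]
  have : (Subtype.val '' range (ofTest D) : Set (WithLp 2 (L2 D × L2Vec D))) =
      LinearMap.range (testPair D) := by
    ext z
    constructor
    · rintro ⟨_, ⟨φ, rfl⟩, rfl⟩
      exact ⟨φ, rfl⟩
    · rintro ⟨φ, rfl⟩
      exact ⟨_, ⟨φ, rfl⟩, rfl⟩
  rw [this]
  exact v.2

lemma norm_sq_toLp {F : Type*} [NormedAddCommGroup F] {μ : Measure Plane} {f : Plane → F}
    (hf : MemLp f 2 μ) : ENNReal.ofReal (‖hf.toLp f‖ ^ 2) = ∫⁻ x, ‖f x‖ₑ ^ 2 ∂μ := by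
  rw [Lp.norm_toLp, ← ENNReal.toReal_pow, ENNReal.ofReal_toReal (ENNReal.pow_ne_top hf.2.ne),
    eLpNorm_eq_lintegral_rpow_enorm_toReal two_ne_zero ENNReal.ofNat_ne_top]
  simp only [ENNReal.toReal_ofNat, one_div]
  rw [← ENNReal.rpow_natCast, ← ENNReal.rpow_mul]
  simp

lemma support_test {D : InterfaceGeometry} (φ : 𝓓(D.Ω, ℝ)) :
    Function.support (φ : Plane → ℝ) ⊆ D.Ω := (subset_tsupport _).trans φ.tsupport_subset

lemma support_grad_test {D : InterfaceGeometry} (φ : 𝓓(D.Ω, ℝ)) :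
    Function.support (∇ (φ : Plane → ℝ)) ⊆ D.Ω := by
  refine Subset.trans ?_ ((support_fderiv_subset ℝ).trans φ.tsupport_subset)
  intro x hx hx'
  exact hx (by simp [gradient, hx'])

/-- The Poincaré inequality on `H¹₀(Ω)`. -/
lemma exists_poincare (D : InterfaceGeometry) :
    ∃ C : ℝ, 0 ≤ C ∧ ∀ v : H10 D, ‖fn D v‖ ≤ C * ‖grad D v‖ := by
  set K : ℝ≥0 := eLpNormLESNormFDerivOfLeConst ℝ (volume : Measure Plane) (D.Ω : Set Plane) 1 2
  set M : ℝ≥0∞ := volume (D.Ω : Set Plane) ^ (1 / 2 : ℝ) with hM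
  have hMt : M ≠ ∞ := ENNReal.rpow_ne_top_of_nonneg (by norm_num) D.isBounded.measure_lt_top.ne
  refine ⟨(K * M).toReal, ENNReal.toReal_nonneg, fun v => ?_⟩
  refine (denseRange_ofTest D).induction_on (p := fun v => ‖fn D v‖ ≤ (K * M).toReal * ‖grad D v‖) v
    (isClosed_le (by fun_prop) (by fun_prop)) fun φ => ?_
  have e1 : ‖fn D (ofTest D φ)‖ = (eLpNorm φ 2 D.μΩ).toReal :=
    Lp.norm_toLp _ (memLp_test φ _)
  have e2 : ‖grad D (ofTest D φ)‖ = (eLpNorm (∇ (φ : Plane → ℝ)) 2 D.μΩ).toReal :=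
    Lp.norm_toLp _ (memLp_grad_test φ _)
  rw [e1, e2, ← ENNReal.toReal_mul]
  refine ENNReal.toReal_mono (ENNReal.mul_ne_top (ENNReal.mul_ne_top ENNReal.coe_ne_top hMt)
    (memLp_grad_test φ _).2.ne) ?_
  have h1 := eLpNorm_le_eLpNorm_fderiv_of_le (volume : Measure Plane) (F := ℝ) (u := φ)
    (s := (D.Ω : Set Plane)) (p := 1) (q := 2) (φ.contDiff.of_le (by simp)) (support_test φ) le_rfl
    (by simp) (by norm_num) D.isBounded
  have h2 : eLpNorm (fderiv ℝ (φ : Plane → ℝ)) 1 volume = eLpNorm (∇ (φ : Plane → ℝ)) 1 D.μΩ := by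
    rw [eLpNorm_restrict_eq_of_support_subset (support_grad_test φ)]
    refine eLpNorm_congr_norm_ae (.of_forall fun x => ?_)
    simp [gradient]
  have h3 := eLpNorm_le_eLpNorm_mul_rpow_measure_univ (μ := D.μΩ) (p := 1) (q := 2) (by norm_num)
    (memLp_grad_test φ D.μΩ).1
  rw [eLpNorm_restrict_eq_of_support_subset (support_test φ)]
  refine (h1.trans ?_)
  rw [ENNReal.coe_one, h2, mul_assoc]
  gcongr
  refine h3.trans ?_
  rw [Measure.restrict_apply_univ, mul_comm, hM]
  norm_num

/-- Restriction of test functions to `Γ`. -/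
def restrictΓ (D : InterfaceGeometry) : 𝓓(D.Ω, ℝ) →ₗ[ℝ] L2Γ D where
  toFun φ := (memLp_test φ D.μΓ).toLp φ
  map_add' _ _ := rfl
  map_smul' _ _ := rfl

/-- The trace operator `v ↦ v|_Γ`, `H¹₀(Ω) → L²(Γ)`: the continuous extension of `φ ↦ φ|_Γ` from
`C_c^∞(Ω)`. -/
def trace (D : InterfaceGeometry) : H10 D →L[ℝ] L2Γ D := (restrictΓ D).extendOfNorm (ofTest D)

/-- The trace operator does extend the restriction of test functions. -/
lemma trace_ofTest (D : InterfaceGeometry) (φ : 𝓓(D.Ω, ℝ)) :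
    trace D (ofTest D φ) = restrictΓ D φ := by
  obtain ⟨-, C, hC⟩ := exists_trace_bound D
  refine LinearMap.extendOfNorm_eq (denseRange_ofTest D) ⟨Real.sqrt C, fun φ => ?_⟩ φ
  have h := hC φ (φ.contDiff.of_le (by simp)) φ.hasCompactSupport
  have hm : Measurable fun x => ‖φ x‖ₑ ^ 2 := by
    have h2 := φ.continuous.measurable
    fun_prop
  have h1 : ∫⁻ x, ‖φ x‖ₑ ^ 2 = ∫⁻ x, ‖φ x‖ₑ ^ 2 ∂D.μΩ := by
    rw [setLIntegral_eq_of_support_subset]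
    refine fun x hx => support_test φ fun h0 => hx (by simp [h0])
  have h2 : ∫⁻ x, ‖∇ (φ : Plane → ℝ) x‖ₑ ^ 2 = ∫⁻ x, ‖∇ (φ : Plane → ℝ) x‖ₑ ^ 2 ∂D.μΩ := by
    rw [setLIntegral_eq_of_support_subset]
    refine fun x hx => support_grad_test φ fun h0 => hx (by simp [h0])
  rw [lintegral_add_left hm, h1, h2, ← norm_sq_toLp (memLp_test φ D.μΓ),
    ← norm_sq_toLp (memLp_test φ D.μΩ), ← norm_sq_toLp (memLp_grad_test φ D.μΩ),
    ← ENNReal.ofReal_add (by positivity) (by positivity), ← ENNReal.ofReal_coe_nnreal,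
    ← ENNReal.ofReal_mul (by positivity), ENNReal.ofReal_le_ofReal_iff (by positivity)] at h
  have h3 := H10_norm_sq (ofTest D φ)
  change ‖ofTest D φ‖ ^ 2 = ‖(memLp_test φ D.μΩ).toLp φ‖ ^ 2 +
    ‖(memLp_grad_test φ D.μΩ).toLp (∇ (φ : Plane → ℝ))‖ ^ 2 at h3
  rw [← h3] at h
  change ‖(memLp_test φ D.μΓ).toLp φ‖ ≤ _
  refine abs_le_of_sq_le_sq' ?_ (by positivity) |>.2
  rw [mul_pow, Real.sq_sqrt (by positivity)]
  exact h

/-! ## The control problem -/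

/-- The data of the control problem: the diffusion coefficients `β⁻, β⁺ > 0`, the source
`f ∈ L²(Ω)`, the desired state `y_d ∈ L²(Ω)`, the regularization parameter `α > 0` and the real
control bounds `u_a < u_b`. -/
structure ControlData (D : InterfaceGeometry) where
  βm : ℝ
  βp : ℝ
  βm_pos : 0 < βm
  βp_pos : 0 < βp
  f : L2 D
  yd : L2 D
  α : ℝ
  α_pos : 0 < α
  ua : ℝ
  ub : ℝ
  ua_lt_ub : ua < ub

namespace ControlData

variable {D : InterfaceGeometry} (P : ControlData D)

/-- `a(y, v) = ∫_{Ω⁻} β⁻ ∇y·∇v + ∫_{Ω⁺} β⁺ ∇y·∇v`. -/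
def a (y v : H10 D) : ℝ :=
  (∫ x in (D.inner : Set Plane), P.βm * ⟪grad D y x, grad D v x⟫_ℝ) +
    ∫ x in D.outer, P.βp * ⟪grad D y x, grad D v x⟫_ℝ

/-- The Lax–Milgram theorem. -/
lemma existsUnique_of_coercive {V : Type*} [NormedAddCommGroup V] [InnerProductSpace ℝ V]
    [CompleteSpace V] {B : V →L[ℝ] V →L[ℝ] ℝ} (hB : IsCoercive B) (ℓ : V →L[ℝ] ℝ) :
    ∃! y : V, ∀ v, B y v = ℓ v := by
  have hw : ∀ y, (∀ v, B y v = ℓ v) ↔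
      hB.continuousLinearEquivOfBilin y = (InnerProductSpace.toDual ℝ V).symm ℓ := by
    intro y
    rw [ext_iff_inner_right ℝ]
    refine forall_congr' fun v => ?_
    rw [hB.continuousLinearEquivOfBilin_apply, InnerProductSpace.toDual_symm_apply]
  refine ⟨hB.continuousLinearEquivOfBilin.symm
    ((InnerProductSpace.toDual ℝ V).symm ℓ), (hw _).2 (by simp), fun y hy => ?_⟩
  rw [← (hw y).1 hy]
  simp

/-- The form `a` is bounded and coercive on `H¹₀(Ω)`. -/
lemma exists_bilin :
    ∃ B : H10 D →L[ℝ] H10 D →L[ℝ] ℝ, (∀ y v, B y v = P.a y v) ∧ IsCoercive B := by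
  have hsub1 : (D.inner : Set Plane) ⊆ D.Ω := subset_closure.trans D.closure_inner_subset
  have hsub2 : D.outer ⊆ D.Ω := sdiff_subset
  have hmo : MeasurableSet D.outer := D.Ω.isOpen.measurableSet.diff isClosed_closure.measurableSet
  let R (A : Set Plane) : H10 D →L[ℝ] Lp Plane 2 (D.μΩ.restrict A) :=
    (LpToLpRestrictCLM Plane Plane ℝ D.μΩ 2 A).comp (grad D)
  have hR : ∀ A : Set Plane, A ⊆ D.Ω → MeasurableSet A → ∀ y v : H10 D,
      ⟪R A y, R A v⟫_ℝ = ∫ x in A, ⟪grad D y x, grad D v x⟫_ℝ := by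
    intro A hA hAm y v
    have hmu : (volume : Measure Plane).restrict A = D.μΩ.restrict A :=
      (Measure.restrict_restrict_of_subset hA).symm
    rw [L2.inner_def, hmu]
    refine integral_congr_ae ?_
    filter_upwards [LpToLpRestrictCLM_coeFn ℝ A (grad D y),
      LpToLpRestrictCLM_coeFn ℝ A (grad D v)] with x h1 h2
    change ⟪LpToLpRestrictCLM Plane Plane ℝ D.μΩ 2 A (grad D y) x,
      LpToLpRestrictCLM Plane Plane ℝ D.μΩ 2 A (grad D v) x⟫_ℝ = _
    rw [h1, h2]
  let B : H10 D →L[ℝ] H10 D →L[ℝ] ℝ :=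
    P.βm • (innerSL ℝ).bilinearComp (R D.inner) (R D.inner) +
      P.βp • (innerSL ℝ).bilinearComp (R D.outer) (R D.outer)
  have hB : ∀ y v, B y v = P.a y v := by
    intro y v
    change P.βm * ⟪R D.inner y, R D.inner v⟫_ℝ + P.βp * ⟪R D.outer y, R D.outer v⟫_ℝ = _
    rw [hR _ hsub1 D.inner.isOpen.measurableSet, hR _ hsub2 hmo, ControlData.a,
      integral_const_mul, integral_const_mul]
  refine ⟨B, hB, ?_⟩
  obtain ⟨C, hC0, hC⟩ := exists_poincare D
  have hm : 0 < min P.βm P.βp := lt_min P.βm_pos P.βp_pos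
  refine ⟨min P.βm P.βp / (C ^ 2 + 1), by positivity, fun v => ?_⟩
  have hint : Integrable (fun x => ⟪grad D v x, grad D v x⟫_ℝ) D.μΩ := L2.integrable_inner _ _
  have hae : (D.Ω : Set Plane) =ᵐ[volume] ((D.inner : Set Plane) ∪ D.outer : Set Plane) := by
    have h0 : ∀ᵐ x, x ∉ D.Γ := measure_eq_zero_iff_ae_notMem.1 (volume_Γ D)
    filter_upwards [h0] with x hx
    refine propext ⟨fun h => ?_, fun h => h.elim (fun h' => hsub1 h') (fun h' => hsub2 h')⟩
    by_cases hc : x ∈ closure (D.inner : Set Plane)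
    · refine Or.inl ?_
      by_contra hn
      exact hx (by rw [InterfaceGeometry.Γ, D.inner.isOpen.frontier_eq]; exact ⟨hc, hn⟩)
    · exact Or.inr ⟨h, hc⟩
  have hsum : ‖grad D v‖ ^ 2 = (∫ x in (D.inner : Set Plane), ⟪grad D v x, grad D v x⟫_ℝ) +
      ∫ x in D.outer, ⟪grad D v x, grad D v x⟫_ℝ := by
    rw [← real_inner_self_eq_norm_sq, L2.inner_def, setIntegral_congr_set hae]
    refine setIntegral_union ?_ hmo (hint.mono_measure (Measure.restrict_mono hsub1 le_rfl)) (hint.mono_measure (Measure.restrict_mono hsub2 le_rfl))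
    exact disjoint_left.2 fun x hx hx' => hx'.2 (subset_closure hx)
  have hn1 : 0 ≤ ∫ x in (D.inner : Set Plane), ⟪grad D v x, grad D v x⟫_ℝ :=
    integral_nonneg fun x => real_inner_self_nonneg
  have hn2 : 0 ≤ ∫ x in D.outer, ⟪grad D v x, grad D v x⟫_ℝ :=
    integral_nonneg fun x => real_inner_self_nonneg
  have hlow : min P.βm P.βp * ‖grad D v‖ ^ 2 ≤ B v v := by
    rw [hB, ControlData.a, integral_const_mul, integral_const_mul, hsum, mul_add]
    exact add_le_add (mul_le_mul_of_nonneg_right (min_le_left _ _) hn1)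
      (mul_le_mul_of_nonneg_right (min_le_right _ _) hn2)
  have hP : ‖fn D v‖ ^ 2 ≤ C ^ 2 * ‖grad D v‖ ^ 2 := by
    rw [← mul_pow]
    exact pow_le_pow_left₀ (norm_nonneg _) (hC v) 2
  calc min P.βm P.βp / (C ^ 2 + 1) * ‖v‖ * ‖v‖
      = min P.βm P.βp / (C ^ 2 + 1) * ‖v‖ ^ 2 := by ring
    _ ≤ min P.βm P.βp / (C ^ 2 + 1) * ((C ^ 2 + 1) * ‖grad D v‖ ^ 2) := by
        gcongr
        rw [H10_norm_sq]
        linarith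
    _ = min P.βm P.βp * ‖grad D v‖ ^ 2 := by field_simp
    _ ≤ B v v := hlow

/-- `y` is the weak solution of the state equation with control `u`:
`a(y, v) = (f, v) + ⟨u, v⟩` for all `v ∈ H¹₀(Ω)`. -/
def IsWeakState (u : L2Γ D) (y : H10 D) : Prop :=
  ∀ v : H10 D, P.a y v = (∫ x, P.f x * fn D v x ∂D.μΩ) + ∫ x, u x * trace D v x ∂D.μΓ

/-- Every control has exactly one weak state. -/
theorem existsUnique_isWeakState (u : L2Γ D) : ∃! y : H10 D, P.IsWeakState u y := by
  obtain ⟨B, hB, hcoer⟩ := P.exists_bilin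
  let ℓ : H10 D →L[ℝ] ℝ := (innerSL ℝ P.f).comp (fn D) + (innerSL ℝ u).comp (trace D)
  have hℓ : ∀ v, ℓ v = (∫ x, P.f x * fn D v x ∂D.μΩ) + ∫ x, u x * trace D v x ∂D.μΓ := by
    intro v
    change ⟪P.f, fn D v⟫_ℝ + ⟪u, trace D v⟫_ℝ = _
    rw [L2.inner_def, L2.inner_def]
    simp [mul_comm]
  obtain ⟨y, hy, huniq⟩ := existsUnique_of_coercive hcoer ℓ
  refine ⟨y, fun v => (hB y v).symm.trans ((hy v).trans (hℓ v)), fun z hz => huniq z fun v => ?_⟩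
  exact (hB z v).trans ((hz v).trans (hℓ v).symm)

/-- The solution operator `S : L²(Γ) → H¹₀(Ω)`, mapping a control to its unique weak state. -/
def S (u : L2Γ D) : H10 D := (P.existsUnique_isWeakState u).choose

/-- The admissible controls: `u ∈ L²(Γ)` with `u_a ≤ u ≤ u_b` a.e. on `Γ`. -/
def Uad : Set (L2Γ D) := {u | ∀ᵐ x ∂D.μΓ, P.ua ≤ u x ∧ u x ≤ P.ub}

/-- The cost functional `J(y, u) = ½ ∫_Ω (y - y_d)² + (α/2) ∫_Γ u²`. -/
def J (y : H10 D) (u : L2Γ D) : ℝ :=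
  1 / 2 * (∫ x, (fn D y x - P.yd x) ^ 2 ∂D.μΩ) + P.α / 2 * ∫ x, u x ^ 2 ∂D.μΓ

/-- The reduced cost functional. -/
def reducedCost (u : L2Γ D) : ℝ := P.J (P.S u) u

/-- `(y, u)` solves the control problem: `u` is an admissible minimizer of the reduced cost
and `y` is the state associated with `u`. -/
def IsSolution (y : H10 D) (u : L2Γ D) : Prop :=
  u ∈ P.Uad ∧ y = P.S u ∧ ∀ w ∈ P.Uad, P.reducedCost u ≤ P.reducedCost w

/-- The variational inequality `⟨α u + p, w - u⟩ ≥ 0` for all admissible `w`. -/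
def VariationalInequality (u : L2Γ D) (p : H10 D) : Prop :=
  ∀ w ∈ P.Uad, 0 ≤ ∫ x, (P.α * u x + trace D p x) * (w x - u x) ∂D.μΓ

/-- The pointwise projection of a real number onto `[u_a, u_b]`. -/
def proj (c : ℝ) : ℝ := min P.ub (max P.ua c)

/-- The projection formula `u = P_{[u_a, u_b]}(-p|_Γ / α)`, a.e. on `Γ`. -/
def ProjectionFormula (u : L2Γ D) (p : H10 D) : Prop :=
  ∀ᵐ x ∂D.μΓ, u x = P.proj (-(1 / P.α) * trace D p x)

end ControlData

end InterfaceControl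

end

namespace InterfaceControl

/-! The form `a` is symmetric, bounded and coercive (`exists_bilin`), so Lax–Milgram supplies both
the state and the adjoint state, and the control-to-state map is affine (`S_add_smul_sub`). Hence on
the segment from the minimizer `u` to an admissible `w` the reduced cost is exactly a quadratic
polynomial in `t`, and no differentiability theory is needed. With `z = S w - S u`, its linear
coefficient is `(S u - y_d, z) + α⟨u, w - u⟩`. Testing the adjoint equation with `z`, and the
equation for `z` (`a_S_sub`) with `p`, turns `(S u - y_d, z)` into `⟨p, w - u⟩`. Minimality makes
the linear coefficient nonnegative, which is the variational inequality.

The equivalence with the projection formula rests on the pointwise obtuse angle property of the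
projection onto an interval. From the formula to the inequality, it is integrated over `Γ`.
Conversely, the projected function `π` is itself admissible, so it may serve as the competitor in
the variational inequality; adding the two inequalities gives `α‖π - w‖² ≤ 0`. This avoids
localizing to subsets of `Γ`. -/

/-- The inner product of `L²(μ)` as an integral. -/
lemma L2_inner_eq {μ : Measure Plane} (f g : Lp ℝ 2 μ) : ⟪f, g⟫_ℝ = ∫ x, f x * g x ∂μ := by
  rw [L2.inner_def]
  simp [mul_comm]

/-- If `0 ≤ t c + t² d` for all `t ∈ (0, 1]`, then `c ≥ 0`. -/
lemma nonneg_of_forall_quadratic_nonneg {c d : ℝ}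
    (h : ∀ t : ℝ, 0 < t → t ≤ 1 → 0 ≤ t * c + t ^ 2 * d) : 0 ≤ c := by
  refine le_of_forall_pos_le_add fun ε hε => ?_
  have hd : 0 < |d| + 1 := by positivity
  -- Small enough that `t|d| ≤ ε`, and at most 1 as `h` demands; the `+ 1` covers `d = 0`.
  set t : ℝ := min 1 (ε / (|d| + 1))
  have ht : 0 < t := lt_min one_pos (by positivity)
  have h1 : t * (|d| + 1) ≤ ε := (le_div_iff₀ hd).1 (min_le_right _ _)
  have h2 : 0 ≤ c + t * d := by
    refine nonneg_of_mul_nonneg_right (b := c + t * d) ?_ ht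
    linarith [h t ht (min_le_left _ _), show t * (c + t * d) = t * c + t ^ 2 * d by ring]
  nlinarith [le_abs_self d]

namespace ControlData

variable {D : InterfaceGeometry} (P : ControlData D)

/-! ### Variational inequality and pointwise projection -/

lemma proj_mem (c : ℝ) : P.ua ≤ P.proj c ∧ P.proj c ≤ P.ub :=
  ⟨le_min P.ua_lt_ub.le (le_max_left _ _), min_le_left _ _⟩

/-- The obtuse angle property of the projection onto `[u_a, u_b]`. -/
lemma proj_sub_mul_nonneg (c : ℝ) {s : ℝ} (hs : P.ua ≤ s ∧ s ≤ P.ub) :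
    0 ≤ (P.proj c - c) * (s - P.proj c) := by
  have h := P.ua_lt_ub
  unfold proj
  -- Inside the interval the first factor vanishes; outside, the projection is an endpoint and both
  -- factors have the same sign.
  rcases le_total P.ua c with h1 | h1
  · rw [max_eq_right h1]
    rcases le_total P.ub c with h2 | h2
    · rw [min_eq_left h2]
      nlinarith [hs.2]
    · rw [min_eq_right h2]
      simp
  · rw [max_eq_left h1, min_eq_right h.le]
    exact mul_nonneg (sub_nonneg.2 h1) (sub_nonneg.2 hs.1)

/-- The pointwise projection of an `L²(Γ)` function is represented by an admissible control. -/
lemma exists_mem_Uad_eq_proj (r : L2Γ D) :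
    ∃ w ∈ P.Uad, ∀ᵐ x ∂D.μΓ, w x = P.proj (-(1 / P.α) * r x) := by
  have hm : AEStronglyMeasurable (fun x => P.proj (-(1 / P.α) * r x)) D.μΓ := by
    have hc : Continuous fun c : ℝ => P.proj (-(1 / P.α) * c) := by
      unfold proj
      fun_prop
    exact hc.comp_aestronglyMeasurable (Lp.aestronglyMeasurable r)
  -- A bounded function is in `L²(Γ)` because `Γ` has finite length.
  have hL : MemLp (fun x => P.proj (-(1 / P.α) * r x)) 2 D.μΓ :=
    MemLp.of_bound hm (max |P.ua| |P.ub|) (.of_forall fun x =>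
      abs_le_max_abs_abs (P.proj_mem _).1 (P.proj_mem _).2)
  refine ⟨hL.toLp _, ?_, hL.coeFn_toLp⟩
  filter_upwards [hL.coeFn_toLp] with x hx
  rw [hx]
  exact P.proj_mem _

/-- Lets the expansions below be done with Hilbert space algebra, with no integrability side
conditions. -/
lemma variationalInequality_iff_inner (w : L2Γ D) (q : H10 D) :
    P.VariationalInequality w q ↔ ∀ v ∈ P.Uad, 0 ≤ ⟪P.α • w + trace D q, v - w⟫_ℝ := by
  refine forall₂_congr fun v _ => ?_
  rw [L2_inner_eq]
  refine iff_of_eq (congrArg _ (integral_congr_ae ?_))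
  filter_upwards [Lp.coeFn_add (P.α • w) (trace D q), Lp.coeFn_smul P.α w,
    Lp.coeFn_sub v w] with x h1 h2 h3
  rw [h1, h3, Pi.add_apply, h2]
  rfl

/-- For admissible controls, the variational inequality is equivalent to the projection formula. -/
theorem variationalInequality_iff_projectionFormula {w : L2Γ D} (hw : w ∈ P.Uad) (q : H10 D) :
    P.VariationalInequality w q ↔ P.ProjectionFormula w q := by
  have hα := P.α_pos
  have hc : ∀ s r : ℝ, P.α * s + r = P.α * (s - -(1 / P.α) * r) := by
    intro s r
    field_simp
    ring
  constructor
  · intro h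
    obtain ⟨π, hπ, hπx⟩ := P.exists_mem_Uad_eq_proj (trace D q)
    have h1 := (P.variationalInequality_iff_inner w q).1 h π hπ
    -- The left factor is `α π + q = α (π - c)` with `c = -q/α`, so the integrand is `-α (π - c)(w -
    -- π)`, which is nonpositive by the obtuse angle property at `s = w`.
    have h2 : ⟪P.α • w + trace D q + P.α • (π - w), π - w⟫_ℝ ≤ 0 := by
      rw [L2_inner_eq]
      refine integral_nonpos_of_ae ?_
      filter_upwards [hπx, hw, Lp.coeFn_add (P.α • w + trace D q) (P.α • (π - w)),
        Lp.coeFn_add (P.α • w) (trace D q), Lp.coeFn_smul P.α w, Lp.coeFn_smul P.α (π - w),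
        Lp.coeFn_sub π w] with x e1 e2 e3 e4 e5 e6 e7
      rw [e3, Pi.add_apply, e4, Pi.add_apply, e5, e6]
      simp only [Pi.smul_apply, e7, Pi.sub_apply, smul_eq_mul, Pi.zero_apply]
      rw [hc, e1]
      nlinarith [mul_nonneg hα.le (P.proj_sub_mul_nonneg (-(1 / P.α) * trace D q x) e2)]
    rw [inner_add_left, real_inner_smul_left, real_inner_self_eq_norm_sq] at h2
    -- Subtracting `h1` from `h2` leaves `α‖π - w‖² ≤ 0`.
    have h3 : π = w := by
      rw [← sub_eq_zero, ← norm_eq_zero, ← sq_eq_zero_iff]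
      exact le_antisymm (nonpos_of_mul_nonpos_right (by linarith) hα) (sq_nonneg _)
    rwa [h3] at hπx
  · intro h v hv
    refine integral_nonneg_of_ae ?_
    filter_upwards [h, hv] with x e1 e2
    rw [hc, e1, mul_assoc]
    exact mul_nonneg hα.le (P.proj_sub_mul_nonneg _ e2)

/-! ### Affine control-to-state map and quadratic cost -/

lemma a_comm (y v : H10 D) : P.a y v = P.a v y := by
  unfold ControlData.a
  congr 1 <;> exact integral_congr_ae (.of_forall fun x => congrArg _ (real_inner_comm _ _))

lemma isWeakState_S (u : L2Γ D) : P.IsWeakState u (P.S u) :=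
  (P.existsUnique_isWeakState u).choose_spec.1

lemma isWeakState_iff_inner (u : L2Γ D) (y : H10 D) :
    P.IsWeakState u y ↔ ∀ v, P.a y v = ⟪P.f, fn D v⟫_ℝ + ⟪u, trace D v⟫_ℝ := by
  simp only [IsWeakState, L2_inner_eq]

lemma eq_S_of_isWeakState {u : L2Γ D} {y : H10 D} (h : P.IsWeakState u y) : y = P.S u :=
  (P.existsUnique_isWeakState u).unique h (P.isWeakState_S u)

/-- The solution operator is affine. -/
lemma S_add_smul_sub (u w : L2Γ D) (t : ℝ) :
    P.S (u + t • (w - u)) = P.S u + t • (P.S w - P.S u) := by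
  obtain ⟨B, hB, -⟩ := P.exists_bilin
  -- By uniqueness it is enough that the right-hand side solves the state equation; the weights `1 -
  -- t` and `t` sum to 1, so the source `f` appears exactly once.
  refine (P.eq_S_of_isWeakState ((P.isWeakState_iff_inner _ _).2 fun v => ?_)).symm
  have hu := (P.isWeakState_iff_inner _ _).1 (P.isWeakState_S u) v
  have hw := (P.isWeakState_iff_inner _ _).1 (P.isWeakState_S w) v
  rw [← hB] at hu hw ⊢
  simp only [map_add, map_smul, map_sub, FunLike.coe_add, FunLike.coe_smul, FunLike.coe_sub,
    Pi.add_apply, Pi.smul_apply, Pi.sub_apply, hu, hw, inner_add_left, real_inner_smul_left,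
    inner_sub_left, smul_eq_mul]
  ring

/-- The source `f` cancels in the difference of two state equations. With `v` the adjoint state,
this moves the change of state onto the interface. -/
lemma a_S_sub (u w : L2Γ D) (v : H10 D) :
    P.a (P.S w - P.S u) v = ⟪w - u, trace D v⟫_ℝ := by
  obtain ⟨B, hB, -⟩ := P.exists_bilin
  have hu := (P.isWeakState_iff_inner _ _).1 (P.isWeakState_S u) v
  have hw := (P.isWeakState_iff_inner _ _).1 (P.isWeakState_S w) v
  rw [← hB] at hu hw ⊢
  rw [map_sub, FunLike.coe_sub, Pi.sub_apply, hu, hw, inner_sub_left]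
  ring

lemma J_eq (y : H10 D) (u : L2Γ D) :
    P.J y u = 1 / 2 * ‖fn D y - P.yd‖ ^ 2 + P.α / 2 * ‖u‖ ^ 2 := by
  rw [← real_inner_self_eq_norm_sq, ← real_inner_self_eq_norm_sq, L2_inner_eq, L2_inner_eq, J]
  congr 2
  · refine integral_congr_ae ?_
    filter_upwards [Lp.coeFn_sub (fn D y) P.yd] with x hx
    rw [hx, Pi.sub_apply, sq]
  · simp only [sq]

lemma add_smul_sub_mem_Uad {u w : L2Γ D} (hu : u ∈ P.Uad) (hw : w ∈ P.Uad) {t : ℝ} (h0 : 0 ≤ t)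
    (h1 : t ≤ 1) : u + t • (w - u) ∈ P.Uad := by
  change ∀ᵐ x ∂D.μΓ, _
  filter_upwards [hu, hw, Lp.coeFn_add u (t • (w - u)), Lp.coeFn_smul t (w - u),
    Lp.coeFn_sub w u] with x hu hw e1 e2 e3
  rw [e1, Pi.add_apply, e2, Pi.smul_apply, e3, Pi.sub_apply]
  exact (convex_Icc P.ua P.ub).add_smul_sub_mem hu hw ⟨h0, h1⟩

/-! ### Adjoint state and first-order condition -/

/-- The adjoint equation has a solution. -/
lemma exists_adjoint (g : L2 D) : ∃ p : H10 D, ∀ v, P.a v p = ⟪g, fn D v⟫_ℝ := by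
  obtain ⟨B, hB, hcoer⟩ := P.exists_bilin
  -- Lax–Milgram places the unknown in the first slot; symmetry of `a` then moves it to the second.
  obtain ⟨p, hp, -⟩ := existsUnique_of_coercive hcoer ((innerSL ℝ g).comp (fn D))
  exact ⟨p, fun v => (P.a_comm v p).trans ((hB p v).symm.trans (hp v))⟩

/-- The first-order necessary condition: an admissible minimizer of the reduced cost satisfies the
variational inequality with the adjoint state. -/
theorem variationalInequality_of_minimizer {u : L2Γ D} (hu : u ∈ P.Uad)
    (hmin : ∀ w ∈ P.Uad, P.reducedCost u ≤ P.reducedCost w) {p : H10 D}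
    (hp : ∀ v, P.a v p = ⟪fn D (P.S u) - P.yd, fn D v⟫_ℝ) : P.VariationalInequality u p := by
  refine (P.variationalInequality_iff_inner u p).2 fun w hw => ?_
  set z := P.S w - P.S u with hz
  refine nonneg_of_forall_quadratic_nonneg
    -- `d` is the exact `t²` coefficient of the reduced cost along `u + t (w - u)`.
    (d := 1 / 2 * ‖fn D z‖ ^ 2 + P.α / 2 * ‖w - u‖ ^ 2) fun t ht ht1 => ?_
  have h := hmin _ (P.add_smul_sub_mem_Uad hu hw ht.le ht1)
  -- Both sides equal `a(z, p)`: the adjoint equation tested with `z`, and the equation for `z`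
  -- tested with `p`.
  have hzp : ⟪fn D (P.S u) - P.yd, fn D z⟫_ℝ = ⟪trace D p, w - u⟫_ℝ := by
    rw [← hp, hz, a_S_sub, real_inner_comm]
  -- Both squares are expanded about `t = 0`; the zeroth-order terms cancel against the cost at `u`.
  rw [reducedCost, reducedCost, J_eq, J_eq, S_add_smul_sub, ← hz, map_add, map_smul,
    add_sub_right_comm, norm_add_sq_real, norm_add_sq_real, norm_smul, norm_smul,
    real_inner_smul_right, real_inner_smul_right, hzp, mul_pow, mul_pow, Real.norm_eq_abs,
    sq_abs] at h
  rw [inner_add_left, real_inner_smul_left]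
  linarith

end ControlData

end InterfaceControl

theorem mainTheorem4 (D : InterfaceControl.InterfaceGeometry)
    (P : InterfaceControl.ControlData D)
    (y : InterfaceControl.H10 D) (u : InterfaceControl.L2Γ D) (hsol : P.IsSolution y u) :
    (∃ p : InterfaceControl.H10 D,
      (∀ v : InterfaceControl.H10 D, P.a y v =
        (∫ x, P.f x * InterfaceControl.fn D v x ∂D.μΩ) + ∫ x, u x * InterfaceControl.trace D v x ∂D.μΓ) ∧
      (∀ v : InterfaceControl.H10 D, P.a v p =
        ∫ x, (InterfaceControl.fn D (P.S u) x - P.yd x) * InterfaceControl.fn D v x ∂D.μΩ) ∧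
      P.VariationalInequality u p ∧
      P.ProjectionFormula u p) ∧
    (∀ w ∈ P.Uad, ∀ q : InterfaceControl.H10 D,
      P.VariationalInequality w q ↔ P.ProjectionFormula w q) := by
  obtain ⟨hu, rfl, hmin⟩ := hsol
  obtain ⟨p, hp⟩ := P.exists_adjoint (InterfaceControl.fn D (P.S u) - P.yd)
  have hVI := P.variationalInequality_of_minimizer hu hmin hp
  refine ⟨⟨p, P.isWeakState_S u, fun v => ?_, hVI,
    (P.variationalInequality_iff_projectionFormula hu p).1 hVI⟩,
    fun w hw q => P.variationalInequality_iff_projectionFormula hw q⟩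
  rw [hp, InterfaceControl.L2_inner_eq]
  refine integral_congr_ae ?_
  filter_upwards [Lp.coeFn_sub (InterfaceControl.fn D (P.S u)) P.yd] with x hx
  rw [hx, Pi.sub_apply]
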